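/- For an integer $e\ge 2$, an $e$-cycle is a permutation (of a finite set) with exactly one nontrivial cycle, of length $e$, all other points being fixed; its support is the set of the $e$ points that it moves. Let $d,r\ge 2$ and $e_1,\dots,e_{r-1}\ge 2$ be integers with $$\sum_{i=1}^{r-1}(e_i-1)=d-1,$$ and let $\tau$ be a fixed $d$-cycle. Then the number of tuples $(\sigma_1,\dots,\sigma_{r-1})$ such that each $\sigma_i$ is an $e_i$-cycle in the symmetric group on the support of $\tau$ and $\sigma_1\sigma_2\cdots\sigma_{r-1}=\tau$ equals $d^{\,r-2}$. -/

import Mathlib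

/-- `σ` is an `e`-cycle: it has exactly one nontrivial cycle, of length `e`
(all other points are fixed). In particular `2 ≤ e`. -/
def IsPureCycle {α : Type*} [Fintype α] [DecidableEq α] (e : ℕ) (σ : Equiv.Perm α) : Prop :=
  σ.IsCycle ∧ σ.support.card = e

/-- The set of factorizations of `τ` of type `(e 0, …, e (n - 1))`: the tuples
`(σ 0, …, σ (n - 1))` such that `σ i` is an `e i`-cycle that only moves points of the support
of `τ` (that is, a cycle in the symmetric group on the support of `τ`) and the ordered product
`σ 0 * σ 1 * ⋯ * σ (n - 1)` is `τ`. -/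
def Factorizations {α : Type*} [Fintype α] [DecidableEq α] (τ : Equiv.Perm α) {n : ℕ}
    (e : Fin n → ℕ) : Set (Fin n → Equiv.Perm α) :=
  {σ | (∀ i, IsPureCycle (e i) (σ i) ∧ (σ i).support ⊆ τ.support) ∧ (List.ofFn σ).prod = τ}

/-!
Write `d` for the number of points and call a set that meets each cycle of `π` (fixed points
included) exactly once a transversal of `π`. A transversal chooses a root in every cycle, so a
permutation with a transversal is a rooted forest whose trees are cycles, and the formula follows
by counting in two ways how such a forest grows into one tree.

Multiplying `π` by an `e`-cycle `σ` lowers the number `k` of cycles by at most `e - 1`, with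
equality exactly when `σ` moves points of `e` different cycles of `π`; it then glues these cycles
together (`numCycles_add_one_le`, `merging_of_numCycles`, `numCycles_mul_of_merging`). As
`∑ (e i - 1) = d - 1`, in a factorization of a `d`-cycle every factor must merge in this way.

A merging `e`-cycle together with a transversal `R'` of `π * σ` amounts to a transversal `R` of
`π`, an arbitrary point `v`, and an ordered choice of `e - 1` roots in `R` outside the cycle of
`v`: the trees of these roots are attached at `v`, in that order. This leaves
`d * (k - 1) * (k - 2) * ⋯ * (k - e + 1)` choices for each `R` (`sum_card_transversals_mul`).
Over all `n` factors, starting from the identity, the falling factorials telescope to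
`d ^ n * (d - 1)!` (`card_mul_card_completions`). Each tuple whose product is a `d`-cycle has been
counted `d` times, once for each root of the final cycle, and the `(d - 1)!` possible products
have equally many factorizations, being conjugate. So each has `d ^ (n - 1)`.
-/

open Equiv Equiv.Perm Finset

section PureCycles

/-! ### Number of cycles and transversals -/

variable {α : Type*} [Fintype α]

/-- The number of cycles of `π`, fixed points included. -/
noncomputable def numCycles (π : Perm α) : ℕ := Nat.card (Quotient (SameCycle.setoid π))

/-- The transversals of `π`: the sets that meet each cycle of `π` (fixed points included) in
exactly one point. -/
noncomputable def transversals (π : Perm α) : Finset (Finset α) := by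
  classical
  exact univ.filter fun R => ∀ x, ∃! r, r ∈ R ∧ π.SameCycle r x

theorem mem_transversals {π : Perm α} {R : Finset α} :
    R ∈ transversals π ↔ ∀ x, ∃! r, r ∈ R ∧ π.SameCycle r x := by
  simp [transversals]

theorem mem_transversals_iff {π : Perm α} {R : Finset α} :
    R ∈ transversals π ↔ (∀ x, ∃ r ∈ R, π.SameCycle r x) ∧
      ∀ r ∈ R, ∀ s ∈ R, π.SameCycle r s → r = s := by
  rw [mem_transversals]
  constructor
  · intro h
    exact ⟨fun x => (h x).exists, fun r hr s hs hrs => (h s).unique ⟨hr, hrs⟩ ⟨hs, .refl _ _⟩⟩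
  · rintro ⟨h, h'⟩ x
    obtain ⟨r, hr, hrx⟩ := h x
    exact ⟨r, ⟨hr, hrx⟩, fun s ⟨hs, hsx⟩ => h' s hs r hr (hsx.trans hrx.symm)⟩

theorem card_of_mem_transversals {π : Perm α} {R : Finset α} (hR : R ∈ transversals π) :
    R.card = numCycles π := by
  rw [mem_transversals_iff] at hR
  rw [numCycles, ← Set.ncard_coe_finset R, ← Nat.card_coe_set_eq]
  refine Nat.card_congr (Equiv.ofBijective (fun r => Quotient.mk (SameCycle.setoid π) r.1) ⟨?_, ?_⟩)
  · rintro ⟨r, hr⟩ ⟨s, hs⟩ h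
    exact Subtype.ext (hR.2 r hr s hs (Quotient.exact h))
  · intro q
    induction q using Quotient.inductionOn with
    | h x =>
      obtain ⟨r, hr, hrx⟩ := hR.1 x
      exact ⟨⟨r, hr⟩, Quotient.sound hrx⟩

theorem transversals_nonempty (π : Perm α) : (transversals π).Nonempty := by
  classical
  refine ⟨univ.image fun x => (Quotient.mk (SameCycle.setoid π) x).out, ?_⟩
  rw [mem_transversals_iff]
  have key : ∀ x, π.SameCycle (Quotient.mk (SameCycle.setoid π) x).out x :=
    fun x => Quotient.exact (Quotient.out_eq (Quotient.mk (SameCycle.setoid π) x))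
  refine ⟨fun x => ⟨_, mem_image_of_mem _ (mem_univ x), key x⟩, ?_⟩
  simp only [mem_image, mem_univ, true_and]
  rintro _ ⟨x, rfl⟩ _ ⟨y, rfl⟩ h
  have : Quotient.mk (SameCycle.setoid π) x = Quotient.mk (SameCycle.setoid π) y :=
    Quotient.sound ((key x).symm.trans (h.trans (key y)))
  rw [this]

theorem card_transversals_of_numCycles_eq_one {π : Perm α} (h : numCycles π = 1) :
    (transversals π).card = Fintype.card α := by
  have hπ : ∀ x y, π.SameCycle x y := by
    intro x y
    have := (Nat.card_eq_one_iff_unique.1 h).1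
    exact Quotient.exact (Subsingleton.elim (Quotient.mk (SameCycle.setoid π) x) (Quotient.mk _ y))
  have : transversals π = univ.powersetCard 1 := by
    ext R
    rw [mem_powersetCard, mem_transversals, card_eq_one]
    constructor
    · intro hR
      refine ⟨subset_univ _, ?_⟩
      have hc := card_of_mem_transversals (mem_transversals.2 hR)
      rwa [h, card_eq_one] at hc
    · rintro ⟨-, r, rfl⟩ x
      exact ⟨r, ⟨mem_singleton_self r, hπ _ _⟩, fun s hs => mem_singleton.1 hs.1⟩
  rw [this, card_powersetCard, Nat.choose_one_right, card_univ]

theorem numCycles_one : numCycles (1 : Perm α) = Fintype.card α := by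
  rw [← card_univ, eq_comm]
  apply card_of_mem_transversals
  simp [mem_transversals_iff]

theorem card_transversals_one : (transversals (1 : Perm α)).card = 1 := by
  rw [card_eq_one]
  refine ⟨univ, ?_⟩
  ext R
  simp [mem_transversals_iff, eq_univ_iff_forall]

/-! ### Cycles of a product in the merging case -/

variable [DecidableEq α]

theorem isPureCycle_iff_cycleType_eq {e : ℕ} {σ : Perm α} :
    IsPureCycle e σ ↔ σ.cycleType = {e} := by
  constructor
  · rintro ⟨h, rfl⟩
    exact h.cycleType
  · intro h
    have hc : σ.IsCycle := card_cycleType_eq_one.1 (by simp [h])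
    refine ⟨hc, ?_⟩
    have := hc.cycleType
    rw [h] at this
    exact (Multiset.singleton_inj.1 this).symm

/-- The points moved by `σ` lie in pairwise distinct cycles of `π`. -/
def Merging (π σ : Perm α) : Prop :=
  ∀ a ∈ σ.support, ∀ b ∈ σ.support, π.SameCycle a b → a = b

/-- Away from the cycles of `π` that meet the support of `σ`, the cycles of `π * σ` are
those of `π`. -/
theorem sameCycle_or_of_sameCycle_mul {π σ : Perm α} {x y : α} (h : (π * σ).SameCycle x y) :
    π.SameCycle x y ∨
      (∃ a ∈ σ.support, π.SameCycle x a) ∧ ∃ a ∈ σ.support, π.SameCycle y a := by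
  obtain ⟨i, rfl⟩ := h.exists_nat_pow_eq
  clear h
  induction i with
  | zero => exact .inl (.refl _ _)
  | succ i ih =>
    rw [pow_succ', Perm.mul_apply]
    set z := ((π * σ) ^ i) x
    by_cases hz : z ∈ σ.support
    · refine .inr ⟨?_, σ z, apply_mem_support.2 hz, ?_⟩
      · rcases ih with ih | ih
        · exact ⟨z, hz, ih⟩
        · exact ih.1
      · rw [Perm.mul_apply, sameCycle_apply_left]
    · have : (π * σ) z = π z := by rw [Perm.mul_apply, notMem_support.1 hz]
      rw [this, sameCycle_apply_right]
      simpa only [sameCycle_apply_left] using ih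

/-- In the merging case the cycles of `π * σ` are unions of cycles of `π`: following `π` from
`σ a`, one stays in the orbit of `a` under `π * σ`, because `σ a` is the only point of the
support of `σ` on that cycle of `π`. -/
theorem Merging.sameCycle_mul_apply {π σ : Perm α} (h : Merging π σ) {a : α}
    (ha : a ∈ σ.support) (n : ℕ) : (π * σ).SameCycle ((π ^ (n + 1)) (σ a)) a := by
  induction n with
  | zero => simpa using (sameCycle_apply_left (f := π * σ) (x := a)).2 (.refl _ _)
  | succ n ih =>
    rw [pow_succ', Perm.mul_apply]
    set z := (π ^ (n + 1)) (σ a) with hz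
    by_cases hzs : z ∈ σ.support
    · have : z = σ a := h z hzs _ (apply_mem_support.2 ha) (by
        rw [hz, sameCycle_pow_left])
      rw [this]
      exact (sameCycle_apply_left (f := π * σ) (x := a)).2 (.refl _ _)
    · have : π z = (π * σ) z := by rw [Perm.mul_apply, notMem_support.1 hzs]
      rw [this, sameCycle_apply_left]
      exact ih

theorem Merging.sameCycle_apply_self {π σ : Perm α} (h : Merging π σ) (a : α) :
    (π * σ).SameCycle (σ a) a := by
  by_cases ha : a ∈ σ.support
  · have := h.sameCycle_mul_apply ha (orderOf π - 1)
    rwa [Nat.sub_add_cancel (orderOf_pos π), pow_orderOf_eq_one] at this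
  · rw [notMem_support.1 ha]

theorem sameCycle_of_apply {α : Type*} [Finite α] {f g : Perm α}
    (h : ∀ x, f.SameCycle (g x) x) {x y : α}
    (hxy : g.SameCycle x y) : f.SameCycle x y := by
  obtain ⟨i, rfl⟩ := hxy.exists_nat_pow_eq
  clear hxy
  induction i with
  | zero => exact .refl _ _
  | succ i ih =>
    rw [pow_succ', Perm.mul_apply]
    exact ih.trans (h _).symm

theorem Merging.sameCycle_right {π σ : Perm α} (h : Merging π σ) {x y : α}
    (hxy : σ.SameCycle x y) : (π * σ).SameCycle x y :=
  sameCycle_of_apply h.sameCycle_apply_self hxy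

theorem Merging.sameCycle_left {π σ : Perm α} (h : Merging π σ) {x y : α}
    (hxy : π.SameCycle x y) : (π * σ).SameCycle x y := by
  refine sameCycle_of_apply (fun x => ?_) hxy
  obtain ⟨a, rfl⟩ := σ.surjective x
  exact ((sameCycle_apply_left (f := π * σ) (x := a)).2 (.refl _ _)).trans
    (h.sameCycle_apply_self a).symm

/-- Multiplying by `σ` lowers the number of cycles by less than the number of cycles of `π` that
meet the support of `σ`: collapsing those cycles to one value gives a map on the points that is
constant on the cycles of `π * σ`. -/
theorem numCycles_add_one_le {π σ : Perm α} (hσ : σ.support.Nonempty) :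
    numCycles π + 1 ≤ numCycles (π * σ) +
      ((Quotient.mk (SameCycle.setoid π)) '' (σ.support : Set α)).ncard := by
  classical
  set q := Quotient.mk (SameCycle.setoid π) with hq
  set B := q '' (σ.support : Set α) with hB
  let h : α → Option (Quotient (SameCycle.setoid π)) := fun x =>
    if q x ∈ B then none else some (q x)
  have hqB : ∀ x, q x ∈ B ↔ ∃ a ∈ σ.support, π.SameCycle x a := by
    intro x
    constructor
    · rintro ⟨a, ha, hax⟩
      exact ⟨a, ha, (Quotient.exact hax : π.SameCycle a x).symm⟩
    · rintro ⟨a, ha, hax⟩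
      exact ⟨a, ha, Quotient.sound (show π.SameCycle a x from hax.symm)⟩
  have hinv : ∀ x y, (π * σ).SameCycle x y → h x = h y := by
    intro x y hxy
    rcases sameCycle_or_of_sameCycle_mul hxy with hxy | ⟨hx, hy⟩
    · have : q x = q y := Quotient.sound hxy
      simp only [h, this]
    · simp only [h, if_pos ((hqB x).2 hx), if_pos ((hqB y).2 hy)]
  let H : Quotient (SameCycle.setoid (π * σ)) → Option (Quotient (SameCycle.setoid π)) :=
    Quotient.lift h hinv
  have hrange : insert none (some '' Bᶜ) ⊆ Set.range H := by
    rintro _ (rfl | ⟨b, hb, rfl⟩)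
    · obtain ⟨a, ha⟩ := hσ
      exact ⟨Quotient.mk _ a, if_pos ⟨a, ha, rfl⟩⟩
    · induction b using Quotient.inductionOn with
      | h x => exact ⟨Quotient.mk _ x, if_neg hb⟩
  have h1 := Set.ncard_le_ncard hrange (Set.toFinite _)
  rw [Set.ncard_insert_of_notMem (by simp), Set.ncard_image_of_injective _
    (Option.some_injective _)] at h1
  have h2 : (Set.range H).ncard ≤ numCycles (π * σ) := by
    rw [← Set.image_univ, numCycles, ← Set.ncard_univ]
    exact Set.ncard_image_le
  have h3 := Set.ncard_add_ncard_compl B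
  rw [numCycles]
  omega

theorem numCycles_add_one_le_add_card {π σ : Perm α} (hσ : σ.support.Nonempty) :
    numCycles π + 1 ≤ numCycles (π * σ) + σ.support.card := by
  have h := numCycles_add_one_le (π := π) hσ
  have h' := Set.ncard_image_le (f := Quotient.mk (SameCycle.setoid π))
    (s := (σ.support : Set α)) (Set.toFinite _)
  rw [Set.ncard_coe_finset] at h'
  omega

/-- A permutation that lowers the number of cycles as far as its support allows is merging. -/
theorem merging_of_numCycles {π σ : Perm α} (hσ : σ.support.Nonempty)
    (h : numCycles (π * σ) + σ.support.card ≤ numCycles π + 1) : Merging π σ := by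
  have h1 := numCycles_add_one_le (π := π) hσ
  have h' := Set.ncard_image_le (f := Quotient.mk (SameCycle.setoid π))
    (s := (σ.support : Set α)) (Set.toFinite _)
  have h2 := Set.ncard_coe_finset σ.support
  have hinj := Set.injOn_of_ncard_image_eq (f := Quotient.mk (SameCycle.setoid π))
    (s := (σ.support : Set α)) (by omega)
  intro a ha b hb hab
  exact hinj ha hb (Quotient.sound hab)

/-! ### Transversals and merging cycles -/

theorem support_formPerm_cons {v : α} {L : List α} (hL : (v :: L).Nodup) (hn : L ≠ []) :
    (v :: L).formPerm.support = (v :: L).toFinset :=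
  List.support_formPerm_of_nodup _ hL fun _ h => hn (List.cons.inj h).2

theorem isCycle_formPerm_cons {α : Type*} [DecidableEq α] {v : α} {L : List α}
    (hL : (v :: L).Nodup) (hn : L ≠ []) : (v :: L).formPerm.IsCycle :=
  List.isCycle_formPerm hL (Nat.succ_le_succ (List.length_pos_iff.2 hn))

theorem merging_formPerm_cons {π : Perm α} {v : α} {L : List α}
    (hL : (v :: L).Nodup) (hn : L ≠ []) {R : Finset α} (hR : R ∈ transversals π)
    (hLR : ∀ a ∈ L, a ∈ R ∧ ¬ π.SameCycle a v) : Merging π (v :: L).formPerm := by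
  have hsupp := support_formPerm_cons hL hn
  intro a ha b hb hab
  rw [hsupp, List.mem_toFinset, List.mem_cons] at ha hb
  rcases ha with rfl | ha <;> rcases hb with rfl | hb
  · rfl
  · exact absurd hab.symm (hLR b hb).2
  · exact absurd hab (hLR a ha).2
  · exact (mem_transversals_iff.1 hR).2 a (hLR a ha).1 b (hLR b hb).1 hab

/-- Gluing the cycles through the representatives in `L` to the cycle of `v` leaves the other
representatives as a transversal. -/
theorem sdiff_mem_transversals {π : Perm α} {v : α} {L : List α}
    (hL : (v :: L).Nodup) (hn : L ≠ []) {R : Finset α} (hR : R ∈ transversals π)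
    (hLR : ∀ a ∈ L, a ∈ R ∧ ¬ π.SameCycle a v) :
    R \ L.toFinset ∈ transversals (π * (v :: L).formPerm) := by
  have hM := merging_formPerm_cons hL hn hR hLR
  have hsupp := support_formPerm_cons hL hn
  have hcyc : (v :: L).formPerm.IsCycle := isCycle_formPerm_cons hL hn
  rw [mem_transversals_iff] at hR ⊢
  simp only [mem_sdiff, List.mem_toFinset]
  constructor
  · intro x
    obtain ⟨r, hr, hrx⟩ := hR.1 x
    by_cases hrL : r ∈ L
    · obtain ⟨s, hs, hsv⟩ := hR.1 v
      refine ⟨s, ⟨hs, fun hsL => (hLR s hsL).2 hsv⟩, ?_⟩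
      refine (hM.sameCycle_left hsv).trans (.trans (hM.sameCycle_right ?_) (hM.sameCycle_left hrx))
      apply hcyc.sameCycle
      · rw [← mem_support, hsupp]; simp
      · rw [← mem_support, hsupp]; simp [hrL]
    · exact ⟨r, ⟨hr, hrL⟩, hM.sameCycle_left hrx⟩
  · have key : ∀ r, r ∈ R ∧ r ∉ L → (∃ a ∈ (v :: L).formPerm.support, π.SameCycle r a) →
        π.SameCycle r v := by
      rintro r ⟨hr, hrL⟩ ⟨a, ha, hra⟩
      rw [hsupp, List.mem_toFinset, List.mem_cons] at ha
      rcases ha with rfl | ha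
      · exact hra
      · exact absurd (hR.2 r hr a (hLR a ha).1 hra ▸ ha) hrL
    intro r hr s hs hrs
    rcases sameCycle_or_of_sameCycle_mul hrs with h | ⟨h1, h2⟩
    · exact hR.2 r hr.1 s hs.1 h
    · exact hR.2 r hr.1 s hs.1 ((key r hr h1).trans (key s hs h2).symm)

/-- Undoing `sdiff_mem_transversals`: if the representative of the glued cycle lies in the old
cycle of `v`, then the other points of the support represent the other old cycles. -/
theorem union_mem_transversals {π : Perm α} {v : α} {L : List α} {R : Finset α} {r₀ : α}
    (hL : (v :: L).Nodup) (hn : L ≠ []) (hM : Merging π (v :: L).formPerm)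
    (hR : R ∈ transversals (π * (v :: L).formPerm)) (hr₀ : r₀ ∈ R) (hrv : π.SameCycle r₀ v) :
    _root_.Disjoint R L.toFinset ∧ R ∪ L.toFinset ∈ transversals π := by
  have hsupp := support_formPerm_cons hL hn
  have hcyc : (v :: L).formPerm.IsCycle := isCycle_formPerm_cons hL hn
  have hvs : v ∈ (v :: L).formPerm.support := by rw [hsupp]; simp
  have hLs : ∀ a ∈ L, a ∈ (v :: L).formPerm.support := fun a ha => by rw [hsupp]; simp [ha]
  rw [mem_transversals_iff] at hR
  have hLv : ∀ a ∈ L, (π * (v :: L).formPerm).SameCycle a r₀ := fun a ha =>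
    (hM.sameCycle_right (hcyc.sameCycle (mem_support.1 (hLs a ha)) (mem_support.1 hvs))).trans
      (hM.sameCycle_left hrv.symm)
  -- a point of `R` never shares an old cycle with a point of `L`
  have key : ∀ r ∈ R, ∀ a ∈ L, ¬ π.SameCycle r a := by
    intro r hr a ha hra
    obtain rfl : r = r₀ := hR.2 r hr r₀ hr₀ ((hM.sameCycle_left hra).trans (hLv a ha))
    obtain rfl : v = a := hM v hvs a (hLs a ha) (hrv.symm.trans hra)
    exact (List.nodup_cons.1 hL).1 ha
  refine ⟨?_, ?_⟩
  · rw [Finset.disjoint_left]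
    intro a ha haL
    exact key a ha a (List.mem_toFinset.1 haL) (.refl _ _)
  rw [mem_transversals_iff]
  simp only [mem_union, List.mem_toFinset]
  constructor
  · intro x
    obtain ⟨r, hr, hrx⟩ := hR.1 x
    rcases sameCycle_or_of_sameCycle_mul hrx with h | ⟨-, a, ha, hxa⟩
    · exact ⟨r, .inl hr, h⟩
    · rw [hsupp, List.mem_toFinset, List.mem_cons] at ha
      rcases ha with rfl | ha
      · exact ⟨r₀, .inl hr₀, hrv.trans hxa.symm⟩
      · exact ⟨a, .inr ha, hxa.symm⟩
  · rintro r (hr | hr) s (hs | hs) hrs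
    · exact hR.2 r hr s hs (hM.sameCycle_left hrs)
    · exact absurd hrs (key r hr s hs)
    · exact absurd hrs.symm (key s hs r hr)
    · exact hM r (hLs r hr) s (hLs s hs) hrs

/-- Every merging cycle `σ` is read off from the point `v` of its support that lies on the old
cycle of a representative `r ∈ R`; its other points then complete `R` to a transversal of `π`. -/
theorem exists_formPerm_cons_eq {π σ : Perm α} {n : ℕ} (hn : 1 ≤ n)
    (hσ : IsPureCycle (n + 1) σ) (hM : Merging π σ) {R : Finset α}
    (hR : R ∈ transversals (π * σ)) :
    ∃ (v : α) (L : List α), L.length = n ∧ σ = (v :: L).formPerm ∧ (v :: L).Nodup ∧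
      _root_.Disjoint R L.toFinset ∧ R ∪ L.toFinset ∈ transversals π := by
  obtain ⟨hcyc, hcard⟩ := hσ
  obtain ⟨a, ha⟩ := hcyc.nonempty_support
  obtain ⟨r, hr, hra⟩ := (mem_transversals_iff.1 hR).1 a
  obtain ⟨v, hv, hrv⟩ : ∃ v ∈ σ.support, π.SameCycle r v := by
    rcases sameCycle_or_of_sameCycle_mul hra with h | h
    · exact ⟨a, ha, h⟩
    · exact h.1
  have hform : (toList σ v).formPerm = σ := by
    rw [formPerm_toList, hcyc.cycleOf_eq (mem_support.1 hv)]
  have hlen : (toList σ v).length = n + 1 := by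
    rw [Perm.length_toList, hcyc.cycleOf_eq (mem_support.1 hv), hcard]
  have hhead := toList_getElem_zero (p := σ) (x := v) hv
  have hnd := Perm.nodup_toList σ v
  obtain ⟨L, hL⟩ : ∃ L, toList σ v = v :: L := by
    rcases h : toList σ v with _ | ⟨b, L⟩
    · simp [h] at hlen
    · simp only [h, List.getElem_cons_zero] at hhead
      exact ⟨L, by rw [hhead]⟩
  rw [hL] at hform hlen hnd
  obtain rfl : L.length = n := by simpa using hlen
  have hne : L ≠ [] := List.length_pos_iff.1 hn
  subst hform
  exact ⟨v, L, rfl, rfl, hnd, union_mem_transversals hnd hne hM hR hr hrv⟩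

/-! ### Counting merging cycles -/

/-- The injective words of length `n` with letters in `S`. -/
def injectiveWords (n : ℕ) (S : Finset α) : Finset (Fin n → α) :=
  univ.filter fun g => Function.Injective g ∧ ∀ i, g i ∈ S

theorem card_injectiveWords (n : ℕ) (S : Finset α) :
    (injectiveWords n S).card = S.card.descFactorial n := by
  have h := Fintype.card_embedding_eq (α := Fin n) (β := S)
  rw [Fintype.card_fin, Fintype.card_coe] at h
  rw [← h, ← Fintype.card_coe]
  refine Fintype.card_congr
    { toFun := fun g => ⟨fun i => ⟨g.1 i, ((mem_filter.1 g.2).2.2 i)⟩, fun i j hij =>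
        (mem_filter.1 g.2).2.1 (congrArg Subtype.val hij)⟩
      invFun := fun g => ⟨fun i => (g i).1, mem_filter.2 ⟨mem_univ _, fun i j hij =>
        g.injective (Subtype.ext hij), fun i => (g i).2⟩⟩
      left_inv := fun _ => rfl
      right_inv := fun _ => rfl }

/-- The cycles of length `e` that are merging for `π`. -/
noncomputable def mergingCycles (π : Perm α) (e : ℕ) : Finset (Perm α) := by
  classical
  exact univ.filter fun σ => IsPureCycle e σ ∧ Merging π σ

theorem mem_mergingCycles {π σ : Perm α} {e : ℕ} :
    σ ∈ mergingCycles π e ↔ IsPureCycle e σ ∧ Merging π σ := by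
  simp [mergingCycles]

open Classical in
/-- The double counting behind the formula: a merging `(n + 1)`-cycle `σ` with a transversal
`R'` of `π * σ` is the same as a transversal `R` of `π`, a point `v` and an ordered choice `L`
of `n` elements of `R` outside the cycle of `v`. The correspondence is
`σ = (v, L₁, …, Lₙ)`, `R' = R \ L`. -/
theorem sum_card_transversals_mul (π : Perm α) {n : ℕ} (hn : 1 ≤ n) :
    ∑ σ ∈ mergingCycles π (n + 1), (transversals (π * σ)).card =
      (transversals π).card * (Fintype.card α * (numCycles π - 1).descFactorial n) := by
  have hcount : ∀ R ∈ transversals π, ∀ v,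
      (injectiveWords n (R.filter fun r => ¬ π.SameCycle r v)).card =
        (numCycles π - 1).descFactorial n := by
    intro R hR v
    obtain ⟨r, ⟨hr, hrv⟩, hr'⟩ := mem_transversals.1 hR v
    have : (R.filter fun r => ¬ π.SameCycle r v) = R.erase r := by
      ext s
      simp only [mem_filter, mem_erase]
      constructor
      · rintro ⟨hs, hsv⟩
        exact ⟨fun h => hsv (h ▸ hrv), hs⟩
      · rintro ⟨hsr, hs⟩
        exact ⟨hs, fun h => hsr (hr' s ⟨hs, h⟩)⟩
    rw [card_injectiveWords, this, card_erase_of_mem hr, card_of_mem_transversals hR]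
  have hlhs : ((transversals π).sigma fun R => (univ : Finset α).sigma fun v =>
      injectiveWords n (R.filter fun r => ¬ π.SameCycle r v)).card =
      (transversals π).card * (Fintype.card α * (numCycles π - 1).descFactorial n) := by
    rw [card_sigma, sum_const_nat]
    intro R hR
    rw [card_sigma, sum_const_nat fun v _ => hcount R hR v, card_univ]
  rw [← hlhs, ← card_sigma, eq_comm]
  have data : ∀ x : (_ : Finset α) × (_ : α) × (Fin n → α),
      x ∈ ((transversals π).sigma fun R => (univ : Finset α).sigma fun v =>
        injectiveWords n (R.filter fun r => ¬ π.SameCycle r v)) →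
      x.1 ∈ transversals π ∧ (x.2.1 :: List.ofFn x.2.2).Nodup ∧ List.ofFn x.2.2 ≠ [] ∧
        ∀ a ∈ List.ofFn x.2.2, a ∈ x.1 ∧ ¬ π.SameCycle a x.2.1 := by
    rintro ⟨R, v, g⟩ h
    simp only [mem_sigma, injectiveWords, mem_filter, mem_univ, true_and] at h
    obtain ⟨hR, hg, hgR⟩ := h
    refine ⟨hR, List.nodup_cons.2 ⟨?_, List.nodup_ofFn.2 hg⟩, ?_, ?_⟩
    · rw [List.mem_ofFn]
      rintro ⟨i, hi⟩
      exact (hgR i).2 (by rw [show g i = v from hi])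
    · intro h
      have := congrArg List.length h
      simp only [List.length_ofFn, List.length_nil] at this
      omega
    · intro a ha
      rw [List.mem_ofFn] at ha
      obtain ⟨i, rfl⟩ := ha
      exact hgR i
  refine Finset.card_bij
    (fun x _ => ⟨(x.2.1 :: List.ofFn x.2.2).formPerm, x.1 \ (List.ofFn x.2.2).toFinset⟩) ?_ ?_ ?_
  · intro x hx
    obtain ⟨hR, hnd, hne, hLR⟩ := data x hx
    rw [mem_sigma, mem_mergingCycles]
    refine ⟨⟨⟨isCycle_formPerm_cons hnd hne, ?_⟩,
      merging_formPerm_cons hnd hne hR hLR⟩, sdiff_mem_transversals hnd hne hR hLR⟩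
    rw [support_formPerm_cons hnd hne,
      List.toFinset_card_of_nodup hnd]
    simp
  · intro x hx y hy hxy
    obtain ⟨hR, hnd, hne, hLR⟩ := data x hx
    obtain ⟨hR', hnd', hne', hLR'⟩ := data y hy
    obtain ⟨R, v, g⟩ := x
    obtain ⟨R', v', g'⟩ := y
    dsimp only at *
    have hσ : (v :: List.ofFn g).formPerm = (v' :: List.ofFn g').formPerm := congrArg Sigma.fst hxy
    have hRR : R \ (List.ofFn g).toFinset = R' \ (List.ofFn g').toFinset := by
      simpa using (Sigma.mk.inj_iff.1 hxy).2
    have hM := merging_formPerm_cons hnd hne hR hLR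
    have hT := sdiff_mem_transversals hnd hne hR hLR
    have hs : v ∈ (v :: List.ofFn g).formPerm.support := by
      rw [support_formPerm_cons hnd hne]; simp
    have hs' : v' ∈ (v :: List.ofFn g).formPerm.support := by
      rw [hσ, support_formPerm_cons hnd' hne']; simp
    have hcyc : (v :: List.ofFn g).formPerm.IsCycle :=
      isCycle_formPerm_cons hnd hne
    -- the base point lies on the old cycle of the representative of the glued cycle
    obtain ⟨r, hr, hrv⟩ := (mem_transversals_iff.1 hR).1 v
    obtain ⟨r', hr', hrv'⟩ := (mem_transversals_iff.1 hR').1 v'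
    have hr1 : r ∈ R \ (List.ofFn g).toFinset :=
      mem_sdiff.2 ⟨hr, fun h => (hLR r (List.mem_toFinset.1 h)).2 hrv⟩
    have hr1' : r' ∈ R \ (List.ofFn g).toFinset := by
      rw [hRR]
      exact mem_sdiff.2 ⟨hr', fun h => (hLR' r' (List.mem_toFinset.1 h)).2 hrv'⟩
    obtain rfl : r = r' := (mem_transversals_iff.1 hT).2 r hr1 r' hr1'
      ((hM.sameCycle_left hrv).trans ((hM.sameCycle_right (hcyc.sameCycle (mem_support.1 hs)
        (mem_support.1 hs'))).trans (hM.sameCycle_left hrv'.symm)))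
    obtain rfl : v = v' := hM v hs v' hs' (hrv.symm.trans hrv')
    have hl : v :: List.ofFn g = v :: List.ofFn g' := by
      have h1 := toList_formPerm_nontrivial _ (by simp; omega) hnd
      have h2 := toList_formPerm_nontrivial _ (by simp; omega) hnd'
      rw [← h1, ← h2, hσ]
      simp
    have hg : g = g' := List.ofFn_injective (List.cons.inj hl).2
    subst hg
    have hsub : (List.ofFn g).toFinset ⊆ R := fun a ha => (hLR a (List.mem_toFinset.1 ha)).1
    have hsub' : (List.ofFn g).toFinset ⊆ R' := fun a ha => (hLR' a (List.mem_toFinset.1 ha)).1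
    have : R = R' := by
      rw [← sdiff_union_of_subset hsub, hRR, sdiff_union_of_subset hsub']
    rw [this]
  · rintro ⟨σ, R⟩ hσR
    rw [mem_sigma, mem_mergingCycles] at hσR
    obtain ⟨⟨hσ, hM⟩, hR⟩ := hσR
    dsimp only at hσ hM hR
    obtain ⟨v, L, rfl, rfl, hnd, hdisj, hT⟩ := exists_formPerm_cons_eq hn hσ hM hR
    have hsupp := support_formPerm_cons hnd (List.length_pos_iff.1 hn)
    refine ⟨⟨R ∪ L.toFinset, v, L.get⟩, ?_, ?_⟩
    · simp only [mem_sigma, injectiveWords, mem_filter, mem_univ, true_and]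
      refine ⟨hT, List.nodup_iff_injective_get.1 (List.nodup_cons.1 hnd).2, fun i => ⟨?_, ?_⟩⟩
      · exact mem_union_right _ (List.mem_toFinset.2 (List.get_mem _ _))
      · intro h
        have := hM _ (by rw [hsupp]; simp) v (by rw [hsupp]; simp) h
        exact (List.nodup_cons.1 hnd).1 (this ▸ List.get_mem _ _)
    · simp only [List.ofFn_get, union_sdiff_cancel_right hdisj]

/-- A merging `(n + 1)`-cycle lowers the number of cycles by exactly `n`. -/
theorem numCycles_mul_of_merging {π σ : Perm α} {n : ℕ} (hn : 1 ≤ n)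
    (hσ : IsPureCycle (n + 1) σ) (hM : Merging π σ) :
    numCycles (π * σ) + n = numCycles π := by
  obtain ⟨R, hR⟩ := transversals_nonempty (π * σ)
  obtain ⟨v, L, rfl, -, hnd, hdisj, hT⟩ := exists_formPerm_cons_eq hn hσ hM hR
  rw [← card_of_mem_transversals hR, ← card_of_mem_transversals hT, card_union_of_disjoint hdisj,
    List.toFinset_card_of_nodup (List.nodup_cons.1 hnd).2]

/-! ### Tuples completing a permutation to a full cycle -/

/-- The tuples of cycles of the lengths prescribed by `e` whose product, multiplied by `π` on the
left, has a single cycle. -/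
noncomputable def completions {n : ℕ} (π : Perm α) (e : Fin n → ℕ) :
    Finset (Fin n → Perm α) := by
  classical
  exact univ.filter fun σ =>
    (∀ i, IsPureCycle (e i) (σ i)) ∧ numCycles (π * (List.ofFn σ).prod) = 1

theorem mem_completions {n : ℕ} {π : Perm α} {e : Fin n → ℕ} {σ : Fin n → Perm α} :
    σ ∈ completions π e ↔
      (∀ i, IsPureCycle (e i) (σ i)) ∧ numCycles (π * (List.ofFn σ).prod) = 1 := by
  simp [completions]

open Classical in
/-- Splitting off the first factor. -/
theorem card_completions_succ {n : ℕ} (π : Perm α) (e : Fin (n + 1) → ℕ) :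
    (completions π e).card =
      ∑ σ with IsPureCycle (e 0) σ, (completions (π * σ) (Fin.tail e)).card := by
  rw [← card_sigma]
  refine Finset.card_bij' (fun σ _ => ⟨σ 0, Fin.tail σ⟩) (fun x _ => Fin.cons x.1 x.2) ?_ ?_ ?_ ?_
  · intro σ hσ
    rw [mem_completions, Fin.forall_fin_succ, List.ofFn_succ, List.prod_cons, ← mul_assoc] at hσ
    simpa [mem_completions, Fin.tail_def, and_assoc] using hσ
  · rintro ⟨σ₀, σ⟩ h
    rw [mem_completions, Fin.forall_fin_succ, List.ofFn_succ, List.prod_cons, ← mul_assoc]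
    simpa [mem_completions, Fin.tail_def, and_assoc] using h
  · intro σ _
    simp
  · rintro ⟨σ₀, σ⟩ _
    simp

/-- There are too few factors to connect the cycles of `π`: a factor of length `e i` lowers the
number of cycles by at most `e i - 1`. -/
theorem completions_eq_empty {n : ℕ} {π : Perm α} {e : Fin n → ℕ}
    (he : ∀ i, 2 ≤ e i) (h : 1 + ∑ i, (e i - 1) < numCycles π) : completions π e = ∅ := by
  classical
  induction n generalizing π with
  | zero =>
    rw [eq_empty_iff_forall_notMem]
    intro σ hσ
    rw [mem_completions] at hσ
    simp at hσ h
    omega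
  | succ n ih =>
    rw [← card_eq_zero, card_completions_succ, sum_eq_zero]
    intro σ hσ
    rw [mem_filter] at hσ
    rw [card_eq_zero]
    refine ih (e := Fin.tail e) (fun i => he i.succ) ?_
    have h1 := numCycles_add_one_le_add_card (π := π) hσ.2.1.nonempty_support
    rw [hσ.2.2] at h1
    rw [Fin.sum_univ_succ] at h
    have := he 0
    simp only [Fin.tail]
    omega

/-- With exactly as many factors as needed, every factor is merging, and
`sum_card_transversals_mul` gives the count by induction. The factor `card α` on the left counts
the transversals of the final full cycle. -/
theorem card_mul_card_completions {n : ℕ} {π : Perm α} {e : Fin n → ℕ}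
    (he : ∀ i, 2 ≤ e i) (h : numCycles π = 1 + ∑ i, (e i - 1)) :
    Fintype.card α * (completions π e).card =
      (transversals π).card * (Fintype.card α ^ n * (numCycles π - 1).factorial) := by
  classical
  induction n generalizing π with
  | zero =>
    simp only [univ_eq_empty, sum_empty, add_zero] at h
    rw [card_transversals_of_numCycles_eq_one h, h]
    have : completions π e = univ := by
      ext σ
      simp only [mem_completions, List.ofFn_zero, List.prod_nil, mul_one, h, and_true, mem_univ,
        iff_true]
      exact fun i => i.elim0
    simp [this]
  | succ n ih =>
    rw [Fin.sum_univ_succ] at h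
    have he0 := he 0
    obtain ⟨m, hm⟩ : ∃ m, e 0 = m + 1 := ⟨e 0 - 1, by omega⟩
    have hsub : mergingCycles π (e 0) ⊆ univ.filter fun σ => IsPureCycle (e 0) σ := fun σ hσ =>
      mem_filter.2 ⟨mem_univ _, (mem_mergingCycles.1 hσ).1⟩
    rw [card_completions_succ, ← sum_subset hsub, mul_sum]
    · have hstep : ∀ σ ∈ mergingCycles π (e 0),
          Fintype.card α * (completions (π * σ) (Fin.tail e)).card =
            (transversals (π * σ)).card *
              (Fintype.card α ^ n * (numCycles π - 1 - m).factorial) := by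
        intro σ hσ
        rw [hm, mem_mergingCycles] at hσ
        have hc := numCycles_mul_of_merging (by omega) hσ.1 hσ.2
        rw [ih (e := Fin.tail e) (fun i => he i.succ) (by simp only [Fin.tail]; omega),
          show numCycles (π * σ) - 1 = numCycles π - 1 - m by omega]
      rw [sum_congr rfl hstep, ← sum_mul, hm, sum_card_transversals_mul π (by omega),
        ← Nat.factorial_mul_descFactorial (show m ≤ numCycles π - 1 by omega)]
      ring
    · intro σ hσ hσ'
      rw [mem_filter] at hσ
      rw [card_eq_zero]
      refine completions_eq_empty (fun i => he i.succ) ?_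
      by_contra hlt
      refine hσ' (mem_mergingCycles.2 ⟨hσ.2, merging_of_numCycles hσ.2.1.nonempty_support ?_⟩)
      rw [hσ.2.2]
      simp only [Fin.tail] at hlt
      omega

theorem numCycles_eq_one_iff (hα : 2 ≤ Fintype.card α) {π : Perm α} :
    numCycles π = 1 ↔ IsPureCycle (Fintype.card α) π := by
  rw [numCycles, Nat.card_eq_one_iff_unique]
  constructor
  · rintro ⟨hs, -⟩
    have hπ : ∀ x y, π.SameCycle x y := fun x y =>
      Quotient.exact (Subsingleton.elim (Quotient.mk (SameCycle.setoid π) x) (Quotient.mk _ y))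
    have hmove : ∀ x, π x ≠ x := by
      intro x hx
      obtain ⟨y, hy⟩ := Fintype.exists_ne_of_one_lt_card (by omega : 1 < Fintype.card α) x
      exact hy ((hπ x y).eq_of_left hx).symm
    obtain ⟨x⟩ : Nonempty α := Fintype.card_pos_iff.1 (by omega)
    refine ⟨⟨x, hmove x, fun y _ => hπ x y⟩, ?_⟩
    rw [← card_univ]
    congr 1
    ext y
    simp [hmove y]
  · rintro ⟨hc, hcard⟩
    have hu : π.support = univ := (card_eq_iff_eq_univ _).1 hcard
    have hmove : ∀ x, π x ≠ x := fun x => mem_support.1 (hu ▸ mem_univ x)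
    obtain ⟨x⟩ : Nonempty α := Fintype.card_pos_iff.1 (by omega)
    refine ⟨⟨fun a b => ?_⟩, ⟨Quotient.mk _ x⟩⟩
    induction a, b using Quotient.inductionOn₂ with
    | h a b => exact Quotient.sound (hc.sameCycle (hmove a) (hmove b))

/-! ### Factorizations of a full cycle -/

open Classical in
/-- The factorizations of `τ` into cycles of lengths `e` inside the full symmetric group. -/
noncomputable def fullFactorizations {n : ℕ} (τ : Perm α) (e : Fin n → ℕ) :
    Finset (Fin n → Perm α) :=
  univ.filter fun σ => (∀ i, IsPureCycle (e i) (σ i)) ∧ (List.ofFn σ).prod = τ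

theorem mem_fullFactorizations {n : ℕ} {τ : Perm α} {e : Fin n → ℕ} {σ : Fin n → Perm α} :
    σ ∈ fullFactorizations τ e ↔
      (∀ i, IsPureCycle (e i) (σ i)) ∧ (List.ofFn σ).prod = τ := by
  simp [fullFactorizations]

theorem IsPureCycle.conj {e : ℕ} {σ : Perm α} (h : IsPureCycle e σ) (g : Perm α) :
    IsPureCycle e (g * σ * g⁻¹) :=
  ⟨h.1.conj, by rw [card_support_conj, h.2]⟩

theorem card_fullFactorizations_conj {n : ℕ} (τ g : Perm α) (e : Fin n → ℕ) :
    (fullFactorizations (g * τ * g⁻¹) e).card = (fullFactorizations τ e).card := by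
  have key : ∀ (g τ : Perm α), (fullFactorizations τ e).card ≤
      (fullFactorizations (g * τ * g⁻¹) e).card := by
    intro g τ
    refine Finset.card_le_card_of_injOn (fun σ i => MulAut.conj g (σ i)) ?_ ?_
    · intro σ hσ
      rw [mem_coe, mem_fullFactorizations] at hσ ⊢
      refine ⟨fun i => (hσ.1 i).conj g, ?_⟩
      have : List.ofFn (fun i => MulAut.conj g (σ i)) = (List.ofFn σ).map (MulAut.conj g) := by
        rw [List.map_ofFn]
        rfl
      rw [this, List.prod_hom, hσ.2, MulAut.conj_apply]
    · intro σ _ ρ _ h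
      funext i
      exact (MulAut.conj g).injective (congrFun h i)
  refine le_antisymm ?_ (key g τ)
  have := key g⁻¹ (g * τ * g⁻¹)
  simpa [mul_assoc] using this

/-- The formula when `τ` moves every point. All full cycles are conjugate, so they have equally
many factorizations, and there are `(d - 1)!` of them. -/
theorem card_fullFactorizations (hα : 2 ≤ Fintype.card α) {n : ℕ} {τ : Perm α}
    (hτ : IsPureCycle (Fintype.card α) τ) {e : Fin n → ℕ} (he : ∀ i, 2 ≤ e i)
    (hsum : ∑ i, (e i - 1) = Fintype.card α - 1) :
    (fullFactorizations τ e).card = Fintype.card α ^ (n - 1) := by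
  classical
  have hn : n ≠ 0 := by
    rintro rfl
    simp only [univ_eq_empty, sum_empty] at hsum
    omega
  have h1 := card_mul_card_completions (π := (1 : Perm α)) he (by rw [numCycles_one]; omega)
  rw [numCycles_one, card_transversals_one, one_mul] at h1
  -- group the completions of the identity by their product, a full cycle
  have h2 : (completions (1 : Perm α) e).card =
      (Fintype.card α - 1).factorial * (fullFactorizations τ e).card := by
    have hmaps : Set.MapsTo (fun σ : Fin n → Perm α => (List.ofFn σ).prod)
        (completions (1 : Perm α) e)
        ((univ.filter fun g : Perm α => g.cycleType = {Fintype.card α} : Finset (Perm α))) := by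
      intro σ hσ
      rw [mem_coe, mem_completions, one_mul] at hσ
      rw [mem_coe, mem_filter, ← isPureCycle_iff_cycleType_eq, ← numCycles_eq_one_iff hα]
      exact ⟨mem_univ _, hσ.2⟩
    rw [card_eq_sum_card_fiberwise hmaps, sum_const_nat (m := (fullFactorizations τ e).card),
      card_of_cycleType_singleton hα le_rfl, Nat.choose_self, mul_one]
    intro τ' hτ'
    rw [mem_filter, ← isPureCycle_iff_cycleType_eq] at hτ'
    obtain ⟨g, rfl⟩ := isConj_iff.1 (hτ.1.isConj hτ'.2.1 (hτ.2.trans hτ'.2.2.symm))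
    rw [← card_fullFactorizations_conj τ g e]
    congr 1
    ext σ
    rw [mem_filter, mem_completions, mem_fullFactorizations, one_mul, and_assoc]
    refine and_congr_right fun _ => and_iff_right_of_imp fun h => ?_
    rw [h, numCycles_eq_one_iff hα]
    exact hτ'.2
  obtain ⟨m, rfl⟩ := Nat.exists_eq_succ_of_ne_zero hn
  have hpos : 0 < Fintype.card α * (Fintype.card α - 1).factorial :=
    Nat.mul_pos (by omega) (Nat.factorial_pos _)
  apply Nat.eq_of_mul_eq_mul_left hpos
  rw [mul_assoc, ← h2, h1, Nat.succ_eq_add_one, Nat.add_sub_cancel, pow_succ]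
  ring

/-! ### Restriction to the support -/

theorem isPureCycle_ofSubtype {S : Finset α} {e : ℕ} {σ : Perm {x // x ∈ S}} :
    IsPureCycle e (ofSubtype σ) ↔ IsPureCycle e σ := by
  rw [isPureCycle_iff_cycleType_eq, isPureCycle_iff_cycleType_eq, ← cycleType_ofSubtype]

theorem support_ofSubtype_subset {S : Finset α} (σ : Perm {x // x ∈ S}) :
    (ofSubtype σ).support ⊆ S := by
  intro x hx
  by_contra hxS
  exact mem_support.1 hx (ofSubtype_apply_of_not_mem σ hxS)

theorem exists_ofSubtype_eq {σ : Perm α} {S : Finset α} (h : σ.support ⊆ S) :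
    ∃ ρ : Perm {x // x ∈ S}, ofSubtype ρ = σ := by
  have hmem : ∀ x, σ x ∈ S ↔ x ∈ S := by
    intro x
    by_cases hx : σ x = x
    · rw [hx]
    · exact iff_of_true (h (apply_mem_support.2 (mem_support.2 hx))) (h (mem_support.2 hx))
  exact ⟨σ.subtypePerm hmem, ofSubtype_subtypePerm hmem fun x hx => h (mem_support.2 hx)⟩

end PureCycles

theorem theorem1p2 {α : Type*} [Fintype α] [DecidableEq α] (d r : ℕ)
    (τ : Equiv.Perm α) (hτ : IsPureCycle d τ)
    (e : Fin (r - 1) → ℕ) (he : ∀ i, 2 ≤ e i)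
    (hsum : ∑ i, (e i - 1) = d - 1) :
    (Factorizations τ e).ncard = d ^ (r - 2) := by
  classical
  obtain ⟨τ', hτ'⟩ := exists_ofSubtype_eq (subset_refl τ.support)
  have hcard : Fintype.card {x // x ∈ τ.support} = d := by rw [Fintype.card_coe, hτ.2]
  have hd : 2 ≤ d := hτ.2 ▸ hτ.1.two_le_card_support
  have hpure : IsPureCycle (Fintype.card {x // x ∈ τ.support}) τ' := by
    rwa [hcard, ← isPureCycle_ofSubtype, hτ']
  have main := card_fullFactorizations (by omega) hpure he (by rw [hcard, hsum])
  have hprod : ∀ σ : Fin (r - 1) → Perm {x // x ∈ τ.support},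
      (List.ofFn fun i => (ofSubtype (σ i) : Perm α)).prod = ofSubtype (List.ofFn σ).prod := by
    intro σ
    rw [← List.prod_hom, List.map_ofFn]
    rfl
  have himage : Factorizations τ e = (fun σ i => ofSubtype (σ i)) ''
      (fullFactorizations τ' e : Set (Fin (r - 1) → Perm {x // x ∈ τ.support})) := by
    ext σ
    constructor
    · rintro ⟨hσ, hσprod⟩
      choose ρ hρ using fun i => exists_ofSubtype_eq (hσ i).2
      obtain rfl : (fun i => ofSubtype (ρ i)) = σ := funext hρ
      refine ⟨ρ, ?_, rfl⟩
      rw [mem_coe, mem_fullFactorizations]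
      refine ⟨fun i => isPureCycle_ofSubtype.1 (hσ i).1, ofSubtype_injective ?_⟩
      rw [← hprod, hσprod, hτ']
    · rintro ⟨ρ, hρ, rfl⟩
      rw [mem_coe, mem_fullFactorizations] at hρ
      refine ⟨fun i => ⟨isPureCycle_ofSubtype.2 (hρ.1 i), support_ofSubtype_subset (ρ i)⟩, ?_⟩
      rw [hprod, hρ.2, hτ']
  rw [himage, Set.ncard_image_of_injective, Set.ncard_coe_finset, main, hcard, Nat.sub_sub]
  intro σ ρ h
  funext i
  exact ofSubtype_injective (congrFun h i)
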